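/- Let $(R,\mathfrak m)$ be a Noetherian Cohen–Macaulay local ring of dimension $d\ge 1$ with infinite residue field, let $I_1,I_2$ be $\mathfrak m$-primary ideals, and let $\ell$ denote length. A reduction of $I_2$ is an ideal $J\subseteq I_2$ with $JI_2^n=I_2^{n+1}$ for some $n$; it is minimal if it is minimal under inclusion among the reductions of $I_2$. Assume that $I_2$ has minimal multiplicity with respect to $I_1$, i.e. $\ell\big(I_1I_2/I_1(y_1,\dots,y_d)\big)=0$ for some minimal reduction $(y_1,\dots,y_d)$ of $I_2$. Assume moreover that there is a minimal reduction $(x_1,\dots,x_d)$ of $I_2$ with $(x_1,\dots,x_d)\subseteq I_1$. For all large $n$ the functions $\ell(R/I_2^n)$, $\ell(R/I_1I_2^n)$ and $\ell(I_2^n/I_1I_2^n)$ agree with polynomials in $n$, and the integers $e_i=e_i(I_2)$, $g_i=g_{i,I_1}(I_2)$ $(0\le i\le d)$ and $f_i=f_{i,I_1}(I_2)$ $(0\le i\le d-1)$ are defined by writing, for $n\gg0$, $$\ell(R/I_2^n)=\sum_{i=0}^{d}(-1)^i e_i\binom{n+d-i}{d-i},\qquad \ell(R/I_1I_2^n)=\sum_{i=0}^{d}(-1)^i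 g_i\binom{n+d-i}{d-i},$$ $$\ell(I_2^n/I_1I_2^n)=\sum_{i=0}^{d-1}(-1)^i f_i\binom{n+d-1-i}{d-1-i}.$$ (Thus $e_0$ is the multiplicity of $I_2$.) Then: 1. $\displaystyle\sum_{n\ge0}\ell(R/I_1I_2^n)\,t^n=\frac{\ell(R/I_1)-t\,[\ell(R/I_1)-e_0(I_2)]}{(1-t)^{d+1}}$. 2. $g_1=e_0(I_2)-\ell(R/I_1)$, and $g_i=0$ for $2\le i\le d$. 3. $\displaystyle\sum_{n\ge0}\ell(I_2^n/I_1I_2^n)\,t^n=\frac{\ell(R/I_1)-t\,[\ell(R/I_1)-e_0(I_2)]}{(1-t)^{d+1}}-\sum_{n\ge0}\ell(R/I_2^n)\,t^n$. 4. $f_0=e_1(I_2)-e_0(I_2)+\ell(R/I_1)$, and $f_i=e_{i+1}(I_2)$ for $1\le i\le d-1$. -/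

import Mathlib

noncomputable section

namespace FiberCone

open IsLocalRing

variable {R : Type*} [CommRing R]

/-- A (Noetherian) local ring is Cohen-Macaulay: the maximal ideal contains a regular sequence
whose number of terms is the Krull dimension. -/
def IsCohenMacaulayLocal (R : Type*) [CommRing R] [IsLocalRing R] : Prop :=
  ∃ rs : List R, (∀ r ∈ rs, r ∈ maximalIdeal R) ∧ RingTheory.Sequence.IsRegular R rs ∧
    ((rs.length : ℕ∞) : WithBot ℕ∞) = ringKrullDim R

/-- `J` is a reduction of `I`: `J ⊆ I` and `J I ^ n = I ^ (n + 1)` for some `n`. -/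
def IsReduction (J I : Ideal R) : Prop :=
  J ≤ I ∧ ∃ n : ℕ, J * I ^ n = I ^ (n + 1)

/-- `J` is a reduction of `I` that is minimal, with respect to inclusion, among all reductions
of `I`. -/
def IsMinimalReduction (J I : Ideal R) : Prop :=
  Minimal (fun K : Ideal R => IsReduction K I) J

/-- `I₂` has minimal multiplicity with respect to `I₁`, in dimension `d`:
the module `I₁ I₂ / I₁ (x₁, …, x_d)` has length zero for some minimal reduction
`(x₁, …, x_d)` of `I₂`. -/
def HasMinimalMultiplicity (d : ℕ) (I₁ I₂ : Ideal R) : Prop :=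
  ∃ x : Fin d → R, IsMinimalReduction (Ideal.span (Set.range x)) I₂ ∧
    Module.length R
      (↥(I₁ * I₂) ⧸ (I₁ * Ideal.span (Set.range x)).submoduleOf (I₁ * I₂)) = 0

/-- The length of `R / I`. -/
def quotLength (I : Ideal R) : ℤ :=
  ((Module.length R (R ⧸ I)).toNat : ℤ)

/-- The Hilbert function `n ↦ ℓ(R / I ^ n)`. -/
def hilbertFun (I : Ideal R) (n : ℕ) : ℤ :=
  quotLength (I ^ n)

/-- The Hilbert function `n ↦ ℓ(R / I₁ I₂ ^ n)`. -/
def mixedHilbertFun (I₁ I₂ : Ideal R) (n : ℕ) : ℤ :=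
  quotLength (I₁ * I₂ ^ n)

/-- The Hilbert function `n ↦ ℓ(I₂ ^ n / I₁ I₂ ^ n)` of the fiber cone
`⨁ₙ I₂ ^ n / I₁ I₂ ^ n`. -/
def fiberHilbertFun (I₁ I₂ : Ideal R) (n : ℕ) : ℤ :=
  ((Module.length R (↥(I₂ ^ n) ⧸ (I₁ * I₂ ^ n).submoduleOf (I₂ ^ n))).toNat : ℤ)

/-- `c 0, …, c D` are the coefficients of the Hilbert polynomial of `H`, in degree `D`:
`H n = ∑ i ≤ D, (-1) ^ i * c i * binom (n + D - i) (D - i)` for all large `n`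
(and `c i = 0` for `i > D`). -/
def IsHilbertCoeffs (D : ℕ) (H c : ℕ → ℤ) : Prop :=
  (∀ i, D < i → c i = 0) ∧
    ∀ᶠ n : ℕ in Filter.atTop,
      H n = ∑ i ∈ Finset.range (D + 1), (-1) ^ i * c i * ((n + (D - i)).choose (D - i) : ℤ)

theorem eq_zero_of_eventually_sum_eq_zero (D : ℕ) : ∀ c : ℕ → ℤ,
    (∀ᶠ n : ℕ in Filter.atTop,
      0 = ∑ i ∈ Finset.range (D + 1), (-1) ^ i * c i * ((n + (D - i)).choose (D - i) : ℤ)) →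
    ∀ i ≤ D, c i = 0 := by
  induction D with
  | zero =>
    intro c hc i hi
    obtain ⟨n, hn⟩ := hc.exists
    obtain rfl : i = 0 := by omega
    simpa using hn.symm
  | succ D ih =>
    intro c hc
    have key : ∀ i ≤ D, c i = 0 := by
      refine ih c ?_
      have hc' := (Filter.tendsto_add_atTop_nat 1).eventually hc
      have hc0 := (Filter.tendsto_sub_atTop_nat 1).eventually hc
      filter_upwards [hc, hc0, Filter.eventually_ge_atTop 1] with n h1 h2 hn
      obtain ⟨m, rfl⟩ : ∃ m, n = m + 1 := ⟨n - 1, by omega⟩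
      rw [Finset.sum_range_succ] at h1 h2
      have h3 : ∀ i ∈ Finset.range (D + 1),
          (-1) ^ i * c i * ((m + 1 + (D + 1 - i)).choose (D + 1 - i) : ℤ)
            = (-1) ^ i * c i * ((m + 1 + (D - i)).choose (D - i) : ℤ)
              + (-1) ^ i * c i * ((m + (D + 1 - i)).choose (D + 1 - i) : ℤ) := by
        intro i hi
        have hi' : i ≤ D := by simpa [Nat.lt_succ_iff] using hi
        obtain ⟨k, rfl⟩ : ∃ k, D = i + k := ⟨D - i, by omega⟩
        have e1 : i + k + 1 - i = k + 1 := by omega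
        have e2 : i + k - i = k := by omega
        rw [e1, e2]
        have : (m + 1 + (k + 1)).choose (k + 1)
            = (m + 1 + k).choose k + (m + (k + 1)).choose (k + 1) := by
          rw [show m + 1 + (k + 1) = (m + 1 + k) + 1 by ring, Nat.choose_succ_succ,
            show m + 1 + k = m + (k + 1) by ring]
        rw [this]
        push_cast
        ring
      rw [Finset.sum_congr rfl h3, Finset.sum_add_distrib] at h1
      simp only [Nat.add_sub_cancel, Nat.sub_self, Nat.choose_zero_right] at h1 h2
      linarith
    intro i hi
    rcases Nat.lt_or_ge D i with h | h
    · obtain rfl : i = D + 1 := by omega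
      obtain ⟨n, hn⟩ := hc.exists
      rw [Finset.sum_range_succ, Finset.sum_eq_zero] at hn
      · simpa using hn.symm
      · intro j hj
        rw [key j (by simpa [Nat.lt_succ_iff] using hj)]
        simp
    · exact key i h

/-- The coefficients of a Hilbert polynomial are determined by the function. -/
theorem IsHilbertCoeffs.unique {D : ℕ} {H c c' : ℕ → ℤ}
    (h : IsHilbertCoeffs D H c) (h' : IsHilbertCoeffs D H c') : c = c' := by
  have key := eq_zero_of_eventually_sum_eq_zero D (fun i => c i - c' i) (by
    filter_upwards [h.2, h'.2] with n h1 h2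
    have : ∑ i ∈ Finset.range (D + 1),
        (-1) ^ i * (c i - c' i) * ((n + (D - i)).choose (D - i) : ℤ) = H n - H n := by
      conv_rhs => rw [h1]
      conv_rhs => arg 2; rw [← h1, h2]
      rw [← Finset.sum_sub_distrib]
      exact Finset.sum_congr rfl fun i _ => by ring
    rw [this, sub_self])
  funext i
  rcases Nat.lt_or_ge D i with hi | hi
  · rw [h.1 i hi, h'.1 i hi]
  · exact sub_eq_zero.mp (key i hi)

open Classical in
/-- The coefficients of the Hilbert polynomial of `H` in degree `D` (zero if there are none). -/
def hilbertCoeffs (D : ℕ) (H : ℕ → ℤ) : ℕ → ℤ :=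
  if h : ∃ c, IsHilbertCoeffs D H c then h.choose else 0

/-- The Hilbert coefficients `e_i(I)`, `0 ≤ i ≤ d`, of `n ↦ ℓ(R / I ^ n)`. -/
def eCoeff (d : ℕ) (I : Ideal R) : ℕ → ℤ :=
  hilbertCoeffs d (hilbertFun I)

/-- The Hilbert coefficients `g_i`, `0 ≤ i ≤ d`, of `n ↦ ℓ(R / I₁ I₂ ^ n)`. -/
def gCoeff (d : ℕ) (I₁ I₂ : Ideal R) : ℕ → ℤ :=
  hilbertCoeffs d (mixedHilbertFun I₁ I₂)

/-- The Hilbert coefficients `f_i`, `0 ≤ i ≤ d - 1`, of the fiber cone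
(for positive dimension `d`). -/
def fCoeff (d : ℕ) (I₁ I₂ : Ideal R) : ℕ → ℤ :=
  hilbertCoeffs (d - 1) (fiberHilbertFun I₁ I₂)

end FiberCone

end

/-! Let `Q` be the minimal reduction with `I₁ I₂ = I₁ Q`; then `I₁ I₂ ^ n = I₁ Q ^ n` for all `n`.
Being primary to the maximal ideal and generated by `d` elements in a Cohen–Macaulay ring of
dimension `d`, `Q` is generated by a regular sequence (`isRegularlyGenerated_of_radical_eq`). Hence,
for `I ⊇ Q`, the quotient `Q ^ n / I Q ^ n` behaves like the degree `n` part of a polynomial ring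
over `R / I` in `d` variables, and its length is a binomial multiple of `ℓ(R / I)`
(`IsRegularlyGenerated.relLength_mul_pow`). Using this for `I₁` and for `Q` itself gives `ℓ(R / I₁
I₂ ^ n) = ℓ(R / I₁) binom (n + d - 1) (d - 1) + ℓ(R / Q) binom (n + d - 1) d` for every `n`.

This requires `Q ≤ I₁`, whereas the reduction assumed to lie in `I₁` may be another one. Comparing
the two shows that `I₁ ⊓ Q` is again a reduction of `I₂`, and minimality of `Q` concludes
(`IsMinimalReduction.le_of_isReduction`).

The function of the fiber cone is eventually a polynomial of degree less than `d`, by a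
Hilbert–Serre argument (`eventuallyBinomial_relLength`). Subtracting it from the mixed function
leaves `ℓ(R / I₂ ^ n)`, so `e_i = g_i + f_{i-1}` for `i ≥ 1` and `e_0 = g_0 = ℓ(R / Q)`. -/

namespace FiberCone

/-! ### Powers of an ideal generated by a regular sequence -/

section RegularlyGenerated

variable {R : Type*} [CommRing R]

/-- `Q` is generated by a weakly regular sequence of length `k`. -/
inductive IsRegularlyGenerated : ℕ → Ideal R → Prop
  | bot : IsRegularlyGenerated 0 ⊥
  | sup {k : ℕ} {Q : Ideal R} (u : R) (hQ : IsRegularlyGenerated k Q)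
      (hu : ∀ a, u * a ∈ Q → a ∈ Q) : IsRegularlyGenerated (k + 1) (Q ⊔ Ideal.span {u})

theorem sup_pow_succ (Q U : Ideal R) (n : ℕ) :
    (Q ⊔ U) ^ (n + 1) = Q ^ (n + 1) ⊔ U * (Q ⊔ U) ^ n := by
  apply le_antisymm
  · induction n with
    | zero => simp
    | succ n ih =>
      rw [pow_succ', Ideal.sup_mul]
      refine sup_le ?_ le_sup_right
      calc Q * (Q ⊔ U) ^ (n + 1) ≤ Q * (Q ^ (n + 1) ⊔ U * (Q ⊔ U) ^ n) := Ideal.mul_mono_right ih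
        _ = Q ^ (n + 2) ⊔ U * (Q * (Q ⊔ U) ^ n) := by
          rw [Ideal.mul_sup, ← pow_succ', mul_left_comm]
        _ ≤ _ := by
          refine sup_le_sup_left (Ideal.mul_mono_right ?_) _
          rw [pow_succ']
          exact Ideal.mul_mono_left le_sup_left
  · refine sup_le (Ideal.pow_right_mono le_sup_left _) ?_
    rw [pow_succ']
    exact Ideal.mul_mono_left le_sup_right

theorem mem_mul_sup_pow_succ {I Q : Ideal R} {u w : R} {n : ℕ} :
    w ∈ I * (Q ⊔ Ideal.span {u}) ^ (n + 1) ↔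
      ∃ a ∈ I * Q ^ (n + 1), ∃ v ∈ I * (Q ⊔ Ideal.span {u}) ^ n, a + u * v = w := by
  rw [sup_pow_succ, Ideal.mul_sup, mul_left_comm, Submodule.mem_sup]
  simp only [Ideal.mem_span_singleton_mul]
  constructor
  · rintro ⟨a, ha, _, ⟨v, hv, rfl⟩, rfl⟩
    exact ⟨a, ha, v, hv, rfl⟩
  · rintro ⟨a, ha, v, hv, rfl⟩
    exact ⟨a, ha, _, ⟨v, hv, rfl⟩, rfl⟩

/-- This is uniqueness of components modulo `I`: with `Q' = Q + (u)`, the quotient `Q' ^ (n + 1) / I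
Q' ^ (n + 1)` is the direct sum of `Q ^ (n + 1) / I Q ^ (n + 1)` and `u` times a copy of `Q' ^ n / I
Q' ^ n`. It replaces the decomposition of a polynomial ring by powers of its last variable. Two
representations differ by `u * (j - v) ∈ Q ^ (n + 1)`, and `u` can be cancelled there. -/
theorem mem_of_add_mul_mem {I Q : Ideal R} {u : R}
    (hu : ∀ n a, u * a ∈ Q ^ n → a ∈ Q ^ n) (hI : Q ⊔ Ideal.span {u} ≤ I) {n : ℕ} {a v : R}
    (ha : a ∈ Q ^ (n + 1))
    (h : a + u * v ∈ I * (Q ⊔ Ideal.span {u}) ^ (n + 1)) :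
    a ∈ I * Q ^ (n + 1) ∧ v ∈ I * (Q ⊔ Ideal.span {u}) ^ n := by
  obtain ⟨i, hi, j, hj, hij⟩ := mem_mul_sup_pow_succ.1 h
  have huI : u ∈ I := hI (Ideal.mem_sup_right (Ideal.mem_span_singleton_self u))
  have h1 : j - v ∈ Q ^ (n + 1) := by
    apply hu
    have : u * (j - v) = a - i := by linear_combination hij
    rw [this]
    exact sub_mem ha (Ideal.mul_le_right hi)
  constructor
  · have : a = i + u * (j - v) := by linear_combination -hij
    rw [this]
    exact add_mem hi (Ideal.mul_mem_mul huI h1)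
  · have : v = j - (j - v) := by ring
    rw [this]
    refine sub_mem hj (?_ : _ ∈ I * (Q ⊔ Ideal.span {u}) ^ n)
    rw [pow_succ'] at h1
    exact Ideal.mul_mono (le_sup_left.trans hI) (Ideal.pow_right_mono le_sup_left n) h1

theorem mem_pow_of_mul_mem_pow_of_forall {Q : Ideal R} {u : R}
    (h : ∀ (n : ℕ), ∀ w ∈ Q ^ n, u * w ∈ Q * Q ^ n → w ∈ Q * Q ^ n) (n : ℕ) (a : R)
    (ha : u * a ∈ Q ^ n) : a ∈ Q ^ n := by
  induction n with
  | zero => simp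
  | succ n ih =>
    rw [pow_succ'] at ha ⊢
    exact h n a (ih (Ideal.mul_le_right ha)) ha

namespace IsRegularlyGenerated

/-- A nonzerodivisor modulo `I ⊇ Q` is a nonzerodivisor on `Q ^ n / I Q ^ n`. -/
theorem mem_mul_pow_of_mul_mem {k : ℕ} {Q : Ideal R} (hQ : IsRegularlyGenerated k Q) :
    ∀ {I : Ideal R} {z : R}, Q ≤ I → (∀ a, z * a ∈ I → a ∈ I) →
      ∀ (n : ℕ), ∀ w ∈ Q ^ n, z * w ∈ I * Q ^ n → w ∈ I * Q ^ n := by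
  induction hQ with
  | bot =>
    intro I z _ hz n w hw h
    cases n with
    | zero => simpa using hz w (by simpa using h)
    | succ n => simp_all
  | @sup k Q u hQ hu ih =>
    -- The induction hypothesis with `I = Q` and `z = u` makes `u` regular on each `Q ^ n / Q ^ (n +
    -- 1)`, hence modulo each `Q ^ n`.
    have hun := mem_pow_of_mul_mem_pow_of_forall (ih le_rfl hu)
    intro I z hI hz n
    induction n with
    | zero => intro w _ h; simpa using hz w (by simpa using h)
    | succ n ihn =>
      intro w hw h
      obtain ⟨a, ha, v, hv, rfl⟩ := mem_mul_sup_pow_succ.1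
        (by simpa using hw : w ∈ ⊤ * (Q ⊔ Ideal.span {u}) ^ (n + 1))
      rw [Ideal.top_mul] at ha hv
      have h' : z * a + u * (z * v) ∈ I * (Q ⊔ Ideal.span {u}) ^ (n + 1) := by
        convert h using 1; ring
      obtain ⟨h1, h2⟩ := mem_of_add_mul_mem hun hI (Ideal.mul_mem_left _ _ ha) h'
      -- The component `a` falls to the induction on the generators, the component `v` to the
      -- induction on the exponent.
      exact mem_mul_sup_pow_succ.2
        ⟨a, ih (le_sup_left.trans hI) hz _ a ha h1, v, ihn v hv h2, rfl⟩

theorem mem_pow_of_mul_mem {k : ℕ} {Q : Ideal R} (hQ : IsRegularlyGenerated k Q) {u : R}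
    (hu : ∀ a, u * a ∈ Q → a ∈ Q) (n : ℕ) (a : R) (ha : u * a ∈ Q ^ n) : a ∈ Q ^ n :=
  mem_pow_of_mul_mem_pow_of_forall (hQ.mem_mul_pow_of_mul_mem le_rfl hu) n a ha

theorem inf_mul_pow {k : ℕ} {Q : Ideal R} (hQ : IsRegularlyGenerated k Q) :
    ∀ {A I : Ideal R}, Q ≤ I → ∀ n : ℕ, A * Q ^ n ⊓ I * Q ^ n ≤ (A ⊓ I) * Q ^ n := by
  induction hQ with
  | bot =>
    intro A I _ n
    cases n <;> simp
  | @sup k Q u hQ hu ih =>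
    intro A I hI n
    induction n with
    | zero => simp
    | succ n ihn =>
      rintro w ⟨hA, hw⟩
      obtain ⟨a, ha, v, hv, rfl⟩ := mem_mul_sup_pow_succ.1 hA
      obtain ⟨h1, h2⟩ := mem_of_add_mul_mem (hQ.mem_pow_of_mul_mem hu) hI (Ideal.mul_le_right ha) hw
      exact mem_mul_sup_pow_succ.2
        ⟨a, ih (le_sup_left.trans hI) _ ⟨ha, h1⟩, v, ihn ⟨hv, h2⟩, rfl⟩

end IsRegularlyGenerated

end RegularlyGenerated

/-! ### Lengths of quotients of ideals -/

section RelativeLength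

variable {R : Type*} [CommRing R]

/-- The length of `A / B` for ideals `B ≤ A`. -/
noncomputable def relLength (B A : Ideal R) : ℕ∞ :=
  Module.length R (A ⧸ B.submoduleOf A)

theorem relLength_top (B : Ideal R) : relLength B ⊤ = Module.length R (R ⧸ B) :=
  (Submodule.Quotient.equiv (B.submoduleOf ⊤) B Submodule.topEquiv (by
    ext x; simp [Submodule.submoduleOf])).length_eq

theorem relLength_eq_zero {A B : Ideal R} (h : A ≤ B) : relLength B A = 0 := by
  rw [relLength, Submodule.submoduleOf_eq_top.2 h]
  exact Module.length_eq_zero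

theorem le_of_relLength_eq_zero {A B : Ideal R} (h : relLength B A = 0) : A ≤ B := by
  rw [relLength, Module.length_eq_zero_iff, Submodule.Quotient.subsingleton_iff] at h
  exact Submodule.submoduleOf_eq_top.1 h

theorem relLength_add {A B C : Ideal R} (hCB : C ≤ B) (hBA : B ≤ A) :
    relLength C A = relLength C B + relLength B A := by
  have hf : C.submoduleOf B ≤ (C.submoduleOf A).comap (Submodule.inclusion hBA) := fun _ hx => hx
  have hg : C.submoduleOf A ≤ (B.submoduleOf A).comap LinearMap.id := fun _ hx => hCB hx
  refine Module.length_eq_add_of_exact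
    (Submodule.mapQ (C.submoduleOf B) (C.submoduleOf A) (Submodule.inclusion hBA) hf)
    (Submodule.mapQ (C.submoduleOf A) (B.submoduleOf A) LinearMap.id hg) ?_ ?_ ?_
  · rw [← LinearMap.ker_eq_bot, Submodule.eq_bot_iff]
    intro x hx
    obtain ⟨x, rfl⟩ := Submodule.mkQ_surjective _ x
    simp only [Submodule.mkQ_apply, LinearMap.mem_ker, Submodule.mapQ_apply,
      Submodule.Quotient.mk_eq_zero] at hx ⊢
    exact hx
  · intro x
    obtain ⟨x, rfl⟩ := Submodule.mkQ_surjective _ x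
    exact ⟨Submodule.Quotient.mk x, rfl⟩
  · intro x
    obtain ⟨x, rfl⟩ := Submodule.mkQ_surjective _ x
    simp only [Submodule.mkQ_apply, Submodule.mapQ_apply, LinearMap.id_apply,
      Submodule.Quotient.mk_eq_zero]
    constructor
    · intro hx
      exact ⟨Submodule.Quotient.mk ⟨x, hx⟩, rfl⟩
    · rintro ⟨z, hz⟩
      obtain ⟨z, rfl⟩ := Submodule.mkQ_surjective _ z
      simp only [Submodule.mkQ_apply, Submodule.mapQ_apply] at hz
      rw [Submodule.Quotient.eq] at hz
      have h1 : (z : R) - x ∈ C := hz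
      have : (x : R) = z - (z - x) := by ring
      change (x : R) ∈ B
      rw [this]
      exact sub_mem z.2 (hCB h1)

/-- Multiplication by `u` identifies `A / (A ∩ (B : u))` with `(B + u A) / B`. -/
theorem relLength_sup_mul (A B : Ideal R) (u : R) :
    relLength B (B ⊔ Ideal.span {u} * A) =
      relLength (A ⊓ Submodule.comap (LinearMap.mulLeft R u) B) A := by
  set T := B ⊔ Ideal.span {u} * A
  have hT : ∀ a : A, u * (a : R) ∈ T := fun a =>
    Ideal.mem_sup_right (Ideal.mul_mem_mul (Ideal.mem_span_singleton_self u) a.2)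
  let f : A →ₗ[R] T ⧸ B.submoduleOf T := (B.submoduleOf T).mkQ ∘ₗ
    ((LinearMap.mulLeft R u).domRestrict A).codRestrict T hT
  have hker : LinearMap.ker f =
      (A ⊓ Submodule.comap (LinearMap.mulLeft R u) B).submoduleOf A := by
    ext a
    have h : a ∈ LinearMap.ker f ↔ u * (a : R) ∈ B := by
      rw [LinearMap.mem_ker, LinearMap.comp_apply, Submodule.mkQ_apply,
        Submodule.Quotient.mk_eq_zero]
      rfl
    rw [h]
    exact ⟨fun h => ⟨a.2, h⟩, fun h => h.2⟩
  have hsurj : Function.Surjective f := by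
    intro t
    obtain ⟨⟨t, ht⟩, rfl⟩ := Submodule.mkQ_surjective _ t
    obtain ⟨b, hb, c, hc, rfl⟩ := Submodule.mem_sup.1 ht
    obtain ⟨a, ha, rfl⟩ := Ideal.mem_span_singleton_mul.1 hc
    refine ⟨⟨a, ha⟩, (Submodule.Quotient.eq _).2 ?_⟩
    change u * a - (b + u * a) ∈ B
    rw [show u * a - (b + u * a) = -b by ring]
    exact neg_mem hb
  rw [relLength, relLength, ← hker]
  exact (f.quotKerEquivOfSurjective hsurj).length_eq.symm

/-- The exact sequence attached to multiplication by `u : A / B → A' / B'`. -/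
theorem relLength_mul_exact {A A' B' : Ideal R} {u : R} (hB : B' ≤ A')
    (hu : Ideal.span {u} * A ≤ A') :
    relLength B' A' = relLength (A ⊓ Submodule.comap (LinearMap.mulLeft R u) B') A +
      relLength (B' ⊔ Ideal.span {u} * A) A' := by
  rw [relLength_add le_sup_left (sup_le hB hu), relLength_sup_mul]

theorem relLength_sup_left (A B : Ideal R) : relLength B (B ⊔ A) = relLength (A ⊓ B) A := by
  have := relLength_sup_mul A B 1
  rw [Ideal.span_singleton_one, Ideal.top_mul] at this
  rw [this]
  congr 2
  ext; simp

/-- Multiplication by the last generator `u` embeds the degree `n` quotient in the degree `n + 1`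
quotient, with cokernel the quotient for one generator fewer. The lengths therefore obey the
recursion of `Nat.multichoose`, which counts monomials. -/
theorem IsRegularlyGenerated.relLength_mul_pow {k : ℕ} {Q : Ideal R}
    (hQ : IsRegularlyGenerated k Q) :
    ∀ {I : Ideal R}, Q ≤ I → ∀ n : ℕ,
      relLength (I * Q ^ n) (Q ^ n) = Nat.multichoose k n * Module.length R (R ⧸ I) := by
  induction hQ with
  | bot =>
    intro I _ n
    cases n with
    | zero => simp [relLength_top]
    | succ n => simp [relLength_eq_zero]
  | @sup k Q u hQ hu ih =>
    intro I hI n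
    have hun := hQ.mem_pow_of_mul_mem hu
    induction n with
    | zero => simp [relLength_top]
    | succ n ihn =>
      have hle : Ideal.span {u} * (Q ⊔ Ideal.span {u}) ^ n ≤ (Q ⊔ Ideal.span {u}) ^ (n + 1) := by
        rw [pow_succ']
        exact Ideal.mul_mono_left le_sup_right
      rw [relLength_mul_exact Ideal.mul_le_right hle]
      have h1 : (Q ⊔ Ideal.span {u}) ^ n ⊓ Submodule.comap (LinearMap.mulLeft R u)
          (I * (Q ⊔ Ideal.span {u}) ^ (n + 1)) = I * (Q ⊔ Ideal.span {u}) ^ n := by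
        ext v
        simp only [Submodule.mem_inf, Submodule.mem_comap, LinearMap.mulLeft_apply]
        constructor
        · rintro ⟨_, h⟩
          exact (mem_of_add_mul_mem hun hI (zero_mem _) (by simpa using h)).2
        · intro h
          exact ⟨Ideal.mul_le_right h,
            mem_mul_sup_pow_succ.2 ⟨0, zero_mem _, v, h, by simp⟩⟩
      have h2 : (Q ⊔ Ideal.span {u}) ^ (n + 1) =
          (I * (Q ⊔ Ideal.span {u}) ^ (n + 1) ⊔ Ideal.span {u} * (Q ⊔ Ideal.span {u}) ^ n) ⊔
            Q ^ (n + 1) := by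
        apply le_antisymm
        · rw [sup_pow_succ]
          exact sup_le le_sup_right (le_sup_right.trans le_sup_left)
        · exact sup_le (sup_le Ideal.mul_le_right hle) (Ideal.pow_right_mono le_sup_left _)
      have h3 : Q ^ (n + 1) ⊓
          (I * (Q ⊔ Ideal.span {u}) ^ (n + 1) ⊔ Ideal.span {u} * (Q ⊔ Ideal.span {u}) ^ n) =
            I * Q ^ (n + 1) := by
        apply le_antisymm
        · rintro a ⟨ha, h⟩
          obtain ⟨b, hb, c, hc, hbc⟩ := Submodule.mem_sup.1 h
          obtain ⟨v, hv, rfl⟩ := Ideal.mem_span_singleton_mul.1 hc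
          refine (mem_of_add_mul_mem (v := -v) hun hI ha ?_).1
          rwa [show a + u * -v = b by linear_combination -hbc]
        · exact le_inf Ideal.mul_le_right
            ((Ideal.mul_mono_right (Ideal.pow_right_mono le_sup_left _)).trans le_sup_left)
      rw [h1, ihn]
      conv_lhs => enter [2, 2]; rw [h2]
      rw [relLength_sup_left, h3, ih (le_sup_left.trans hI), Nat.multichoose_succ_succ]
      push_cast
      ring

end RelativeLength

/-! ### Regular sequences from vanishing of Ext -/

section Grade

open CategoryTheory Abelian RingTheory.Sequence

universe u
variable {R : Type u} [CommRing R]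

/-- Prime avoidance for cosets. -/
theorem exists_add_notMem_of_not_le (s : Finset (Ideal R)) (hs : ∀ p ∈ s, p.IsPrime) (z : R)
    (W : Ideal R) (h : ∀ p ∈ s, ¬ W ⊔ Ideal.span {z} ≤ p) :
    ∃ w ∈ W, ∀ p ∈ s, z + w ∉ p := by
  classical
  induction s using Finset.strongInduction with
  | H s ih =>
    rcases s.eq_empty_or_nonempty with rfl | hne
    · exact ⟨0, zero_mem _, by simp⟩
    -- Minimality of `q` yields an element `b` of all the other primes outside `q`, so a correction
    -- by `w' * b` changes membership in `q` only.
    obtain ⟨q, hq⟩ := s.exists_minimal hne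
    obtain ⟨w, hw, hws⟩ := ih (s.erase q) (Finset.erase_ssubset hq.1)
      (fun p hp => hs p (Finset.mem_of_mem_erase hp)) (fun p hp => h p (Finset.mem_of_mem_erase hp))
    have := hs q hq.1
    by_cases hwq : z + w ∈ q
    · have hWq : ¬ W ≤ q := by
        intro hW
        refine h q hq.1 (sup_le hW ?_)
        rw [Ideal.span_singleton_le_iff_mem]
        simpa using sub_mem hwq (hW hw)
      obtain ⟨w', hw', hw'q⟩ := Set.not_subset.1 hWq
      have hb : ¬ (s.erase q).inf id ≤ q := by
        rw [Ideal.IsPrime.inf_le']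
        · rintro ⟨p, hp, hpq⟩
          have hp' := Finset.mem_erase.1 hp
          exact hp'.1 (le_antisymm hpq (hq.2 hp'.2 hpq))
        · assumption
      obtain ⟨b, hb, hbq⟩ := Set.not_subset.1 hb
      refine ⟨w + w' * b, add_mem hw (Ideal.mul_mem_right _ _ hw'), fun p hp hmem => ?_⟩
      rw [← add_assoc] at hmem
      by_cases hpq : p = q
      · subst hpq
        exact (this.mem_or_mem ((Submodule.add_mem_iff_right _ hwq).1 hmem)).elim hw'q hbq
      · have hp' := Finset.mem_erase.2 ⟨hpq, hp⟩
        have hbp : b ∈ p := (Finset.inf_le hp' : (s.erase q).inf id ≤ id p) hb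
        exact hws p hp' ((Submodule.add_mem_iff_left _ (Ideal.mul_mem_left _ _ hbp)).1 hmem)
    · refine ⟨w, hw, fun p hp => ?_⟩
      by_cases hpq : p = q
      · subst hpq; exact hwq
      · exact hws p (Finset.mem_erase.2 ⟨hpq, hp⟩)

/-- The cyclic module `R / I` as an object of the category of modules. -/
noncomputable abbrev quotObj (I : Ideal R) : ModuleCat.{u} R := ModuleCat.of R (R ⧸ I)

theorem subsingleton_ext_of_iso {N M M' : ModuleCat.{u} R} (e : M ≅ M') {i : ℕ}
    (h : Subsingleton (Ext N M i)) : Subsingleton (Ext N M' i) := by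
  have := ((extFunctorObj N i).mapIso e).addCommGroupIsoToAddEquiv
  have h' : Subsingleton ((extFunctorObj N i).obj M) := h
  exact this.symm.toEquiv.subsingleton

/-- A nonzerodivisor modulo `Q` cuts down the vanishing range of `Ext N (R / Q)` by one. -/
theorem subsingleton_ext_quot_sup (N : ModuleCat.{u} R) (Q : Ideal R) {z : R}
    (hz : ∀ a, z * a ∈ Q → a ∈ Q) {n : ℕ} (h : ∀ i < n + 1, Subsingleton (Ext N (quotObj Q) i)) :
    ∀ i < n, Subsingleton (Ext N (quotObj (Q ⊔ Ideal.span {z})) i) := by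
  intro i hi
  have hreg : IsSMulRegular (quotObj Q) z :=
    (isSMulRegular_quotient_iff_mem_of_smul_mem Q z).2 hz
  have zero1 := AddCommGrpCat.isZero_of_iff_subsingleton.mpr (h i (by omega))
  have zero2 := AddCommGrpCat.isZero_of_iff_subsingleton.mpr (h (i + 1) (by omega))
  have key : Subsingleton (Ext N (ModuleCat.of R (QuotSMulTop z (quotObj Q))) i) :=
    AddCommGrpCat.subsingleton_of_isZero <| ShortComplex.Exact.isZero_of_both_zeros
      ((Ext.covariant_sequence_exact₃' N hreg.smulShortComplex_shortExact) i (i + 1) rfl)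
      (zero1.eq_zero_of_src _) (zero2.eq_zero_of_tgt _)
  refine subsingleton_ext_of_iso (LinearEquiv.toModuleIso ?_) key
  refine (Submodule.quotEquivOfEq _ _ ?_).trans
    (Submodule.quotientQuotientEquivQuotientSup Q (Ideal.span {z}))
  have h1 : (Ideal.span {z} : Ideal R) = Ideal.span {z} • (⊤ : Submodule R R) := by
    rw [smul_eq_mul, Ideal.mul_top]
  rw [h1, Submodule.map_smul'', Submodule.map_top, Submodule.range_mkQ,
    Submodule.ideal_span_singleton_smul]

/-- Vanishing of `Hom(R / Q, R / P)` gives an element of `Q` regular modulo `P`. Coset prime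
avoidance then turns `y 0` into a regular element by adding an element of `P + (y 1, …)`, which
preserves the number of generators. Dividing by it costs one degree of Ext vanishing. -/
theorem exists_isRegularlyGenerated_of_ext [IsNoetherianRing R] (Q : Ideal R) :
    ∀ (n k : ℕ) (P : Ideal R) (y : Fin n → R), IsRegularlyGenerated k P →
      P ⊔ Ideal.span (Set.range y) = Q →
      (∀ i < n, Subsingleton (Ext (quotObj Q) (quotObj P) i)) → IsRegularlyGenerated (k + n) Q := by
  intro n
  induction n with
  | zero =>
    intro k P y hP hQ _
    simpa [← hQ] using hP
  | succ n ih =>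
    intro k P y hP hQ hext
    have h0 : Subsingleton (quotObj Q ⟶ quotObj P) :=
      Ext.addEquiv₀.subsingleton_congr.mp (hext 0 n.succ_pos)
    have h0 : Subsingleton ((R ⧸ Q) →ₗ[R] (R ⧸ P)) :=
      (ModuleCat.homAddEquiv (M := quotObj Q) (N := quotObj P)).symm.subsingleton
    obtain ⟨r, hrQ, hr⟩ := IsSMulRegular.subsingleton_linearMap_iff.mp h0
    rw [Ideal.annihilator_quotient] at hrQ
    set W := Ideal.span (Set.range fun i : Fin n => y i.succ) with hW
    have hy : Ideal.span (Set.range y) = Ideal.span {y 0} ⊔ W := by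
      rw [hW, ← Ideal.span_union]
      congr 1
      rw [← Fin.cons_self_tail y, Fin.range_cons]
      rfl
    have hfin := associatedPrimes.finite R (R ⧸ P)
    have hunion := biUnion_associatedPrimes_eq_compl_regular (R := R) (R ⧸ P)
    obtain ⟨w, hw, hws⟩ := exists_add_notMem_of_not_le hfin.toFinset
      (fun p hp => (hfin.mem_toFinset.1 hp).isPrime) (y 0) (P ⊔ W) (fun p hp hle => by
        have hp := hfin.mem_toFinset.1 hp
        have hrp : r ∈ p := hle (by
          rw [← hQ, hy] at hrQ
          convert hrQ using 1
          ac_rfl)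
        have : r ∈ ⋃ p ∈ associatedPrimes R (R ⧸ P), (p : Set R) :=
          Set.mem_biUnion hp hrp
        rw [hunion] at this
        exact this hr)
    have hz : ∀ a, (y 0 + w) * a ∈ P → a ∈ P := by
      apply (isSMulRegular_quotient_iff_mem_of_smul_mem P (y 0 + w)).1
      by_contra hcon
      have : y 0 + w ∈ ⋃ p ∈ associatedPrimes R (R ⧸ P), (p : Set R) := by
        rw [hunion]; exact hcon
      obtain ⟨p, hp, hmem⟩ := Set.mem_iUnion₂.1 this
      exact hws p (hfin.mem_toFinset.2 hp) hmem
    have := ih (k + 1) (P ⊔ Ideal.span {y 0 + w}) (fun i => y i.succ) (hP.sup _ hz) (by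
      rw [← hQ, hy, ← hW]
      have hwm : w ∈ P ⊔ (Ideal.span {y 0} ⊔ W) :=
        (sup_le_sup_left le_sup_right _ : P ⊔ W ≤ P ⊔ (Ideal.span {y 0} ⊔ W)) hw
      have h0m : y 0 ∈ P ⊔ (Ideal.span {y 0} ⊔ W) :=
        Ideal.mem_sup_right (Ideal.mem_sup_left (Ideal.mem_span_singleton_self _))
      apply le_antisymm
      · refine sup_le (sup_le le_sup_left ?_) (le_sup_right.trans le_sup_right)
        rw [Ideal.span_singleton_le_iff_mem]
        exact add_mem h0m hwm
      · refine sup_le (le_sup_left.trans le_sup_left) (sup_le ?_ le_sup_right)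
        rw [Ideal.span_singleton_le_iff_mem]
        have h1 : y 0 + w ∈ P ⊔ Ideal.span {y 0 + w} ⊔ W :=
          Ideal.mem_sup_left (Ideal.mem_sup_right (Ideal.mem_span_singleton_self _))
        have h2 : w ∈ P ⊔ Ideal.span {y 0 + w} ⊔ W := (sup_le_sup_right le_sup_left _ :
          P ⊔ W ≤ P ⊔ Ideal.span {y 0 + w} ⊔ W) hw
        simpa using sub_mem h1 h2)
      (subsingleton_ext_quot_sup _ P hz hext)
    convert this using 1
    omega

/-- In a Cohen-Macaulay local ring of dimension `d`, a primary ideal for the maximal ideal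
generated by `d` elements is generated by a regular sequence. -/
theorem isRegularlyGenerated_of_radical_eq [IsLocalRing R] [IsNoetherianRing R]
    (hCM : IsCohenMacaulayLocal R) {d : ℕ} (hdim : ringKrullDim R = d) (y : Fin d → R)
    (hy : (Ideal.span (Set.range y)).radical = IsLocalRing.maximalIdeal R) :
    IsRegularlyGenerated d (Ideal.span (Set.range y)) := by
  obtain ⟨rs, hrs, hreg, hlen⟩ := hCM
  rw [hdim] at hlen
  have hlen : rs.length = d := by exact_mod_cast hlen
  set Q := Ideal.span (Set.range y)
  have hreg' : IsRegular (quotObj (⊥ : Ideal R)) rs :=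
    ((Submodule.quotEquivOfEqBot (⊥ : Ideal R) rfl).symm.isRegular_congr rs).1 hreg
  have : Nontrivial (quotObj (⊥ : Ideal R)) := hreg'.nontrivial
  refine Nat.zero_add d ▸ exists_isRegularlyGenerated_of_ext Q d 0 ⊥ y .bot (by simp [Q]) ?_
  rw [← hlen]
  -- Since `R / Q` is supported at the closed point, a regular sequence of length `d` in the maximal
  -- ideal, not necessarily in `Q`, forces `Ext i` of `R / Q` into `R` to vanish for `i < d`.
  refine ModuleCat.subsingleton_ext_of_exists_isRegular (IsLocalRing.maximalIdeal R) _ ?_ _ ?_ rs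
    hrs hreg'
  · rw [Module.support_eq_zeroLocus, Ideal.annihilator_quotient, ← hy,
      PrimeSpectrum.zeroLocus_radical]
  · exact (Submodule.top_ne_ideal_smul_of_le_jacobson_annihilator
      (IsLocalRing.maximalIdeal_le_jacobson _)).symm.lt_top

end Grade

/-! ### Functions that are eventually integral combinations of binomials -/

section EventuallyBinomial

/-- `H n` is eventually an integral combination of the `binom (n + j) j` for `j < s`. -/
def EventuallyBinomial (s : ℕ) (H : ℕ → ℤ) : Prop :=
  ∃ c : ℕ → ℤ, ∀ᶠ n : ℕ in Filter.atTop, H n = ∑ j ∈ Finset.range s, c j * ((n + j).choose j : ℤ)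

namespace EventuallyBinomial

theorem congr {s : ℕ} {H H' : ℕ → ℤ} (h : EventuallyBinomial s H)
    (e : ∀ᶠ n in Filter.atTop, H' n = H n) : EventuallyBinomial s H' := by
  obtain ⟨c, hc⟩ := h
  exact ⟨c, by filter_upwards [hc, e] with n h1 h2; rw [h2, h1]⟩

theorem sub {s : ℕ} {H H' : ℕ → ℤ} (h : EventuallyBinomial s H) (h' : EventuallyBinomial s H') :
    EventuallyBinomial s (fun n => H n - H' n) := by
  obtain ⟨c, hc⟩ := h
  obtain ⟨c', hc'⟩ := h'
  refine ⟨fun j => c j - c' j, ?_⟩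
  filter_upwards [hc, hc'] with n h1 h2
  simp only [h1, h2, sub_mul, Finset.sum_sub_distrib]

theorem succ {s : ℕ} {H : ℕ → ℤ} (h : EventuallyBinomial s H) : EventuallyBinomial (s + 1) H := by
  obtain ⟨c, hc⟩ := h
  refine ⟨fun j => if j < s then c j else 0, ?_⟩
  filter_upwards [hc] with n h1
  rw [h1, Finset.sum_range_succ, if_neg (lt_irrefl s), zero_mul, add_zero]
  exact Finset.sum_congr rfl fun j hj => by rw [if_pos (Finset.mem_range.1 hj)]

theorem comp_pred {s : ℕ} {H : ℕ → ℤ} (h : EventuallyBinomial s H) :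
    EventuallyBinomial s (fun n => H (n - 1)) := by
  obtain ⟨c, hc⟩ := h
  cases s with
  | zero =>
    refine ⟨c, ?_⟩
    filter_upwards [(Filter.tendsto_sub_atTop_nat 1).eventually hc] with n hn
    simpa using hn
  | succ s =>
    have h1 : EventuallyBinomial (s + 1) fun n =>
        ∑ j ∈ Finset.range (s + 1), c j * ((n + j).choose j : ℤ) := ⟨c, by simp⟩
    have h2 : EventuallyBinomial s fun n =>
        ∑ j ∈ Finset.range s, c (j + 1) * ((n + j).choose j : ℤ) := ⟨fun j => c (j + 1), by simp⟩
    refine (h1.sub h2.succ).congr ?_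
    filter_upwards [(Filter.tendsto_sub_atTop_nat 1).eventually hc,
      Filter.eventually_ge_atTop 1] with n hn hn1
    obtain ⟨m, rfl⟩ : ∃ m, n = m + 1 := ⟨n - 1, by omega⟩
    rw [Nat.add_sub_cancel] at hn ⊢
    rw [hn, Finset.sum_range_succ', Finset.sum_range_succ', add_sub_right_comm,
      ← Finset.sum_sub_distrib]
    congr 1
    swap; · simp
    refine Finset.sum_congr rfl fun j _ => ?_
    have : (m + 1 + (j + 1)).choose (j + 1) =
        (m + 1 + j).choose j + (m + (j + 1)).choose (j + 1) := by
      rw [show m + 1 + (j + 1) = (m + 1 + j) + 1 by ring, Nat.choose_succ_succ,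
        show m + 1 + j = m + (j + 1) by ring]
    rw [this]
    push_cast
    ring

theorem of_sub_eq {s : ℕ} {F H : ℕ → ℤ} (hF : EventuallyBinomial s F)
    (h : ∀ n, H (n + 1) - H n = F (n + 1)) : EventuallyBinomial (s + 1) H := by
  obtain ⟨c, hc⟩ := hF
  obtain ⟨N, hN⟩ := Filter.eventually_atTop.1 hc
  set G : ℕ → ℤ := fun n => ∑ j ∈ Finset.range s, c j * ((n + (j + 1)).choose (j + 1) : ℤ) with hG
  have hstep : ∀ n ≥ N, H (n + 1) - G (n + 1) = H n - G n := by
    intro n hn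
    have h1 := hN (n + 1) (by omega)
    rw [← h n] at h1
    have h2 : G (n + 1) - G n =
        ∑ j ∈ Finset.range s, c j * ((n + 1 + j).choose j : ℤ) := by
      rw [hG, ← Finset.sum_sub_distrib]
      refine Finset.sum_congr rfl fun j _ => ?_
      have : (n + 1 + (j + 1)).choose (j + 1) =
          (n + 1 + j).choose j + (n + (j + 1)).choose (j + 1) := by
        rw [show n + 1 + (j + 1) = (n + 1 + j) + 1 by ring, Nat.choose_succ_succ,
          show n + 1 + j = n + (j + 1) by ring]
      rw [this]
      push_cast
      ring
    linarith
  have hconst : ∀ n ≥ N, H n - G n = H N - G N := by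
    intro n hn
    induction n, hn using Nat.le_induction with
    | base => rfl
    | succ n hn ih => rw [hstep n hn, ih]
  -- Summation raises each binomial index by one; the constant of summation becomes the coefficient
  -- at `j = 0`.
  refine ⟨fun j => if j = 0 then H N - G N else c (j - 1), ?_⟩
  filter_upwards [Filter.eventually_ge_atTop N] with n hn
  rw [Finset.sum_range_succ']
  simp only [Nat.add_sub_cancel, Nat.succ_ne_zero, if_false, if_true, Nat.choose_zero_right,
    Nat.cast_one, mul_one]
  have := hconst n hn
  simp only [hG] at this ⊢
  linarith

end EventuallyBinomial

end EventuallyBinomial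

/-! ### Hilbert–Serre theorem for quotients of filtrations -/

section Hilbert

variable {R : Type*} [CommRing R] {Q : Ideal R}

/-- The kernel of multiplication by `u` on `A / B`. -/
def kerFiltration (A B : Q.Filtration R) (u : R) : Q.Filtration R where
  N n := A.N n ⊓ Submodule.comap (LinearMap.mulLeft R u) (B.N (n + 1))
  mono n := inf_le_inf (A.mono n) (Submodule.comap_mono (B.mono (n + 1)))
  smul_le n := by
    rw [Submodule.smul_le]
    rintro q hq k ⟨hk, hk'⟩
    refine ⟨A.smul_le n (Submodule.smul_mem_smul hq hk), ?_⟩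
    have := B.smul_le (n + 1) (Submodule.smul_mem_smul hq hk')
    change u * (q * k) ∈ B.N (n + 1 + 1)
    rw [mul_left_comm]
    exact this

/-- The filtration `B + u A`, whose quotient is the cokernel of multiplication by `u`
on `A / B`. -/
def cokerFiltration (A B : Q.Filtration R) (u : R) : Q.Filtration R where
  -- In degree `0` the truncated subtraction gives `A.N 0`; the recursion for lengths uses only
  -- positive degrees.
  N n := B.N n ⊔ Ideal.span {u} * A.N (n - 1)
  mono n := sup_le_sup (B.mono n) (Ideal.mul_mono_right (A.antitone (by omega)))
  smul_le n := by
    rw [Submodule.smul_sup]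
    refine sup_le_sup (B.smul_le n) ?_
    rw [smul_eq_mul, mul_left_comm]
    refine Ideal.mul_mono_right ?_
    cases n with
    | zero => exact Ideal.mul_le_right
    | succ n => exact A.smul_le n

/-- `Z` collects the generators of `Q` already known to annihilate `A / B`. Multiplication by a
further generator `u` has kernel `K / B` and cokernel `A / C`, both killed by `u`, so `u` moves into
`Z`. The first difference of the length is that of the cokernel minus the shifted one of the kernel.
Stability of `K` is the Artin–Rees lemma. -/
theorem eventuallyBinomial_relLength [IsNoetherianRing R] :
    ∀ (s : ℕ) (y : Fin s → R) (Z : Ideal R) (A B : Q.Filtration R), A.Stable → B ≤ A →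
      Q = Z ⊔ Ideal.span (Set.range y) → (∀ n, Z * A.N n ≤ B.N (n + 1)) →
      (∀ n, relLength (B.N n) (A.N n) ≠ ⊤) →
      EventuallyBinomial s (fun n => ((relLength (B.N n) (A.N n)).toNat : ℤ)) := by
  intro s
  induction s with
  | zero =>
    intro y Z A B hA hBA hQ hZ _
    refine ⟨0, ?_⟩
    obtain ⟨n₀, hn₀⟩ := hA
    filter_upwards [Filter.eventually_ge_atTop (n₀ + 1)] with n hn
    obtain ⟨m, rfl⟩ : ∃ m, n = m + 1 := ⟨n - 1, by omega⟩
    have hQZ : Q = Z := by simpa using hQ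
    rw [relLength_eq_zero]
    · simp
    · rw [← hn₀ m (by omega)]
      exact (Ideal.mul_mono_left hQZ.le).trans (hZ m)
  | succ s ih =>
    intro y Z A B hA hBA hQ hZ hfin
    set u := y 0
    set K := kerFiltration A B u
    set C := cokerFiltration A B u
    have huQ : u ∈ Q := by
      rw [hQ]
      exact Ideal.mem_sup_right (Ideal.subset_span ⟨0, rfl⟩)
    have huA : ∀ n, Ideal.span {u} * A.N n ≤ A.N (n + 1) := fun n =>
      (Ideal.mul_mono_left ((Ideal.span_singleton_le_iff_mem Q).2 huQ)).trans (A.smul_le n)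
    have hKA : K ≤ A := fun n => inf_le_left
    have hBK : B ≤ K := fun n => le_inf (hBA n) fun b hb =>
      B.smul_le n (Submodule.smul_mem_smul huQ hb)
    have hBC : B ≤ C := fun n => le_sup_left
    have hCA : C ≤ A := by
      intro n
      refine sup_le (hBA n) ?_
      cases n with
      | zero => exact Ideal.mul_le_right
      | succ n => exact huA n
    have hQ' : Q = (Z ⊔ Ideal.span {u}) ⊔ Ideal.span (Set.range fun i : Fin s => y i.succ) := by
      rw [hQ, sup_assoc, ← Ideal.span_union]
      congr 2
      rw [← Fin.cons_self_tail y, Fin.range_cons]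
      rfl
    have hlen : ∀ n, relLength (B.N n) (A.N n) =
        relLength (B.N n) (K.N n) + relLength (K.N n) (A.N n) := fun n =>
      relLength_add (hBK n) (hKA n)
    have hlen' : ∀ n, relLength (B.N n) (A.N n) =
        relLength (B.N n) (C.N n) + relLength (C.N n) (A.N n) := fun n =>
      relLength_add (hBC n) (hCA n)
    have hBKfin : ∀ n, relLength (B.N n) (K.N n) ≠ ⊤ := fun n h =>
      hfin n (by rw [hlen, h, top_add])
    have hKAfin : ∀ n, relLength (K.N n) (A.N n) ≠ ⊤ := fun n h =>
      hfin n (by rw [hlen, h, add_top])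
    have hCAfin : ∀ n, relLength (C.N n) (A.N n) ≠ ⊤ := fun n h =>
      hfin n (by rw [hlen', h, add_top])
    have hker := ih (fun i => y i.succ) (Z ⊔ Ideal.span {u}) K B (hA.of_le hKA) hBK hQ' (by
      intro n
      rw [Ideal.sup_mul]
      refine sup_le ((Ideal.mul_mono_right (hKA n)).trans (hZ n)) ?_
      rw [Ideal.span_singleton_mul_le_iff]
      exact fun k hk => hk.2) hBKfin
    have hcoker := ih (fun i => y i.succ) (Z ⊔ Ideal.span {u}) A C hA hCA hQ' (by
      intro n
      rw [Ideal.sup_mul]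
      exact sup_le_sup (hZ n) le_rfl) hCAfin
    refine (hcoker.sub hker.comp_pred).of_sub_eq fun n => ?_
    have h1 : relLength (B.N (n + 1)) (A.N (n + 1)) =
        relLength (K.N n) (A.N n) + relLength (C.N (n + 1)) (A.N (n + 1)) :=
      relLength_mul_exact (hBA (n + 1)) (huA n)
    rw [h1, hlen n, ENat.toNat_add (hKAfin n) (hCAfin (n + 1)),
      ENat.toNat_add (hBKfin n) (hKAfin n), Nat.add_sub_cancel]
    push_cast
    ring

end Hilbert

/-! ### Hilbert coefficients -/

section HilbertCoefficients

theorem IsHilbertCoeffs.hilbertCoeffs_eq {D : ℕ} {H c : ℕ → ℤ} (h : IsHilbertCoeffs D H c) :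
    hilbertCoeffs D H = c := by
  have hex : ∃ c, IsHilbertCoeffs D H c := ⟨c, h⟩
  rw [hilbertCoeffs, dif_pos hex]
  exact hex.choose_spec.unique h

theorem EventuallyBinomial.exists_isHilbertCoeffs {D : ℕ} {H : ℕ → ℤ}
    (h : EventuallyBinomial (D + 1) H) : ∃ c, IsHilbertCoeffs D H c := by
  obtain ⟨c, hc⟩ := h
  refine ⟨fun i => if i ≤ D then (-1) ^ i * c (D - i) else 0, fun i hi => if_neg (by omega), ?_⟩
  filter_upwards [hc] with n hn
  rw [hn, ← Finset.sum_range_reflect]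
  refine Finset.sum_congr rfl fun i hi => ?_
  have hi : i ≤ D := Nat.lt_succ_iff.1 (Finset.mem_range.1 hi)
  simp only [if_pos hi, Nat.add_sub_cancel]
  rw [← mul_assoc ((-1 : ℤ) ^ i), ← mul_pow]
  simp

/-- The Hilbert coefficients of `n ↦ ℓ binom (D + n) D + e binom (D + n) (D + 1)`. -/
theorem isHilbertCoeffs_choose (D : ℕ) (l e : ℤ) :
    IsHilbertCoeffs (D + 1)
      (fun n => l * ((D + n).choose D : ℤ) + e * ((D + n).choose (D + 1) : ℤ))
      (fun i => if i = 0 then e else if i = 1 then e - l else 0) := by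
  refine ⟨fun i hi => by simp [show i ≠ 0 by omega, show i ≠ 1 by omega], .of_forall fun n => ?_⟩
  rw [Finset.sum_range_succ', Finset.sum_range_succ', Finset.sum_eq_zero]
  · have h : (n + (D + 1)).choose (D + 1) = (D + n).choose D + (D + n).choose (D + 1) := by
      rw [← Nat.choose_succ_succ]
      congr 1
      omega
    simp [h, Nat.add_comm n D]
    ring
  · intro i _
    simp

/-- As `F` is normalised one degree lower, `f i` meets the binomial of index `i + 1`; the extra sign
turns the difference into a sum. -/
theorem IsHilbertCoeffs.sub {D : ℕ} {G F g f : ℕ → ℤ} (hG : IsHilbertCoeffs (D + 1) G g)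
    (hF : IsHilbertCoeffs D F f) :
    IsHilbertCoeffs (D + 1) (fun n => G n - F n)
      (fun i => g i + if i = 0 then 0 else f (i - 1)) := by
  refine ⟨fun i hi => ?_, ?_⟩
  · simp [hG.1 i hi, hF.1 (i - 1) (by omega)]
  · filter_upwards [hG.2, hF.2] with n h1 h2
    rw [h1, h2, Finset.sum_range_succ', Finset.sum_range_succ' _ (D + 1), add_sub_right_comm,
      ← Finset.sum_sub_distrib]
    congr 1
    · refine Finset.sum_congr rfl fun i _ => ?_
      simp only [Nat.succ_ne_zero, if_false, Nat.add_sub_cancel, Nat.add_sub_add_right]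
      ring
    · simp

end HilbertCoefficients

/-! ### Reductions -/

section Reduction

variable {R : Type*} [CommRing R]

theorem IsReduction.mul_pow_eq {J I : Ideal R} (h : IsReduction J I) :
    ∃ n₀, ∀ n ≥ n₀, J * I ^ n = I ^ (n + 1) := by
  obtain ⟨n₀, hn₀⟩ := h.2
  refine ⟨n₀, fun n hn => ?_⟩
  obtain ⟨k, rfl⟩ := Nat.exists_eq_add_of_le hn
  rw [pow_add, ← mul_assoc, hn₀, ← pow_add]
  congr 1
  omega

theorem IsReduction.radical_eq {J I : Ideal R} (h : IsReduction J I) : J.radical = I.radical := by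
  refine le_antisymm (Ideal.radical_mono h.1) ?_
  obtain ⟨n, hn⟩ := h.2
  rw [← Ideal.radical_pow I n.succ_ne_zero, Nat.succ_eq_add_one, ← hn]
  exact Ideal.radical_mono Ideal.mul_le_left

theorem IsReduction.trans {K J I : Ideal R} {n : ℕ} (hJ : IsReduction J I)
    (hKJ : K ≤ J) (h : K * J ^ n = J ^ (n + 1)) : IsReduction K I := by
  obtain ⟨m, hm⟩ := hJ.mul_pow_eq
  have hpow : ∀ k, J ^ k * I ^ m = I ^ (k + m) := by
    intro k
    induction k with
    | zero => simp
    | succ k ih =>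
      rw [pow_succ', mul_assoc, ih, hm _ (by omega)]
      congr 1
      omega
  refine ⟨hKJ.trans hJ.1, n + m, ?_⟩
  rw [← hpow n, ← mul_assoc, h, hpow]
  congr 1
  omega

/-- If a minimal reduction `Q` of `I₂`, generated by a regular sequence, computes `I₁ I₂`, and if
`I₁` contains some reduction of `I₂`, then `I₁` contains `Q`. -/
theorem IsMinimalReduction.le_of_isReduction {I₁ I₂ Q J : Ideal R}
    (hQ : IsMinimalReduction Q I₂) {k : ℕ} (hreg : IsRegularlyGenerated k Q)
    (hmul : ∀ n, I₁ * I₂ ^ n = I₁ * Q ^ n) (hJ : IsReduction J I₂) (hJI : J ≤ I₁) : Q ≤ I₁ := by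
  obtain ⟨n, hn⟩ := hJ.2
  have h1 : Q ^ (n + 1) ≤ I₁ * Q ^ n := by
    rw [← hmul]
    refine (Ideal.pow_right_mono hQ.1.1 _).trans ?_
    rw [← hn]
    exact Ideal.mul_mono_left hJI
  -- By `h1`, `Q ^ (n + 1)` lies in `I₁ Q ^ n ⊓ Q Q ^ n`, and `inf_mul_pow` takes the intersection
  -- inside. So `I₁ ⊓ Q` reduces `Q`, hence `I₂`.
  have h2 : (I₁ ⊓ Q) * Q ^ n = Q ^ (n + 1) := by
    apply le_antisymm
    · rw [pow_succ']
      exact Ideal.mul_mono_left inf_le_right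
    · exact (le_inf h1 (pow_succ' Q n).le).trans (hreg.inf_mul_pow le_rfl n)
  exact (hQ.2 (hQ.1.trans inf_le_right h2) inf_le_right).trans inf_le_left

end Reduction

/-! ### Length formulas -/

section Length

variable {R : Type*} [CommRing R]

theorem length_quotient_ne_top [IsLocalRing R] [IsNoetherianRing R] {I : Ideal R}
    (hI : I.radical = IsLocalRing.maximalIdeal R) : Module.length R (R ⧸ I) ≠ ⊤ := by
  have : IsArtinianRing (R ⧸ I) := by
    apply IsLocalRing.quotient_artinian_of_mem_minimalPrimes_of_isLocalRing
    rw [← Ideal.radical_minimalPrimes, hI, Ideal.minimalPrimes_eq_subsingleton_self]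
    rfl
  have : IsArtinian R (R ⧸ I) :=
    isArtinian_of_surjective_algebraMap (R := R ⧸ I) Ideal.Quotient.mk_surjective
  exact Module.length_ne_top

theorem radical_mul_pow_eq {I₁ I₂ m : Ideal R} (h₁ : I₁.radical = m) (h₂ : I₂.radical = m)
    (n : ℕ) : (I₁ * I₂ ^ n).radical = m := by
  rcases n.eq_zero_or_pos with rfl | hn
  · simpa using h₁
  · rw [Ideal.radical_mul, Ideal.radical_pow _ hn.ne', h₁, h₂, inf_idem]

theorem length_quotient_eq_add {A B : Ideal R} (h : B ≤ A) :
    Module.length R (R ⧸ B) = relLength B A + Module.length R (R ⧸ A) := by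
  rw [← relLength_top, ← relLength_top, relLength_add h le_top]

theorem IsRegularlyGenerated.length_quotient_pow {D : ℕ} {Q : Ideal R}
    (hQ : IsRegularlyGenerated (D + 1) Q) (n : ℕ) :
    Module.length R (R ⧸ Q ^ n) = (D + n).choose (D + 1) * Module.length R (R ⧸ Q) := by
  induction n with
  | zero =>
    rw [← relLength_top, relLength_eq_zero (by simp)]
    simp
  | succ n ih =>
    rw [length_quotient_eq_add (Ideal.pow_le_pow_right n.le_succ), pow_succ',
      hQ.relLength_mul_pow le_rfl, ih, Nat.multichoose_eq, ← add_mul, ← Nat.cast_add,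
      ← add_assoc D n 1, Nat.choose_succ_succ, Nat.choose_symm_add (a := D) (b := n)]
    congr 4
    omega

theorem IsRegularlyGenerated.length_quotient_mul_pow {D : ℕ} {Q I : Ideal R}
    (hQ : IsRegularlyGenerated (D + 1) Q) (hI : Q ≤ I) (n : ℕ) :
    Module.length R (R ⧸ I * Q ^ n) = (D + n).choose D * Module.length R (R ⧸ I) +
      (D + n).choose (D + 1) * Module.length R (R ⧸ Q) := by
  rw [length_quotient_eq_add Ideal.mul_le_right, hQ.relLength_mul_pow hI, hQ.length_quotient_pow,
    Nat.multichoose_eq, Nat.choose_symm_add (a := D) (b := n)]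
  congr 4
  omega

end Length

theorem powerSeries_mk_choose (D : ℕ) (l e : ℤ) :
    PowerSeries.mk (fun n => l * ((D + n).choose D : ℤ) + e * ((D + n).choose (D + 1) : ℤ)) =
      (PowerSeries.C l - PowerSeries.X * PowerSeries.C (l - e)) *
        (PowerSeries.invOneSubPow ℤ (D + 1 + 1) : PowerSeries ℤ) := by
  rw [PowerSeries.invOneSubPow_val_succ_eq_mk_add_choose]
  ext n
  rw [sub_mul, mul_assoc, map_sub, PowerSeries.coeff_C_mul, PowerSeries.coeff_mk,
    PowerSeries.coeff_mk]
  cases n with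
  | zero => simp
  | succ n =>
    rw [PowerSeries.coeff_succ_X_mul, PowerSeries.coeff_C_mul, PowerSeries.coeff_mk,
      show D + 1 + (n + 1) = (D + (n + 1)) + 1 by ring, Nat.choose_succ_succ,
      show D + 1 + n = D + (n + 1) by ring]
    push_cast
    ring

/-! ### Polynomiality for the fiber cone -/

section Adic

variable {R : Type*} [CommRing R]

/-- The filtration `n ↦ I₁ I₂ ^ n` with respect to `Q ≤ I₂`. -/
def mulPowFiltration {Q I₂ : Ideal R} (h : Q ≤ I₂) (I₁ : Ideal R) : Q.Filtration R where
  N n := I₁ * I₂ ^ n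
  mono n := Ideal.mul_mono_right (Ideal.pow_le_pow_right n.le_succ)
  smul_le n := by
    rw [smul_eq_mul, mul_left_comm, pow_succ']
    exact Ideal.mul_mono_right (Ideal.mul_mono_left h)

theorem eventuallyBinomial_fiberHilbertFun [IsNoetherianRing R] {d : ℕ} {I₁ I₂ : Ideal R}
    {y : Fin d → R} (hy : IsReduction (Ideal.span (Set.range y)) I₂)
    (hfin : ∀ n, relLength (I₁ * I₂ ^ n) (I₂ ^ n) ≠ ⊤) :
    EventuallyBinomial d (fiberHilbertFun I₁ I₂) := by
  -- With `I₁ = ⊤` the filtration is `I₂ ^ n`; it is stable for `Q` exactly because `Q` is a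
  -- reduction of `I₂`.
  have key := eventuallyBinomial_relLength d y ⊥ (mulPowFiltration hy.1 ⊤)
    (mulPowFiltration hy.1 I₁) (by
      obtain ⟨n₀, hn₀⟩ := hy.mul_pow_eq
      refine ⟨n₀, fun n hn => ?_⟩
      simp only [mulPowFiltration, Ideal.top_mul]
      exact hn₀ n hn) (fun n => Ideal.mul_mono_left le_top) (by simp) (by simp)
    (by simpa [mulPowFiltration] using hfin)
  simpa [mulPowFiltration] using! key

end Adic

end FiberCone

theorem mainTheorem7 {R : Type*} [CommRing R] [IsLocalRing R] [IsNoetherianRing R]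
    [Infinite (IsLocalRing.ResidueField R)]
    (hCM : FiberCone.IsCohenMacaulayLocal R)
    (d : ℕ) (hd : 1 ≤ d) (hdim : ringKrullDim R = d)
    (I₁ I₂ : Ideal R)
    (hI₁ : I₁.radical = IsLocalRing.maximalIdeal R)
    (hI₂ : I₂.radical = IsLocalRing.maximalIdeal R)
    (hmm : FiberCone.HasMinimalMultiplicity d I₁ I₂)
    (x : Fin d → R)
    (hx : FiberCone.IsMinimalReduction (Ideal.span (Set.range x)) I₂)
    (hxI₁ : Ideal.span (Set.range x) ≤ I₁) :
    -- the Hilbert functions agree with polynomials for large `n`,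
    -- so that the coefficients `e_i`, `g_i`, `f_i` exist
    (FiberCone.IsHilbertCoeffs d (FiberCone.hilbertFun I₂) (FiberCone.eCoeff d I₂) ∧
      FiberCone.IsHilbertCoeffs d (FiberCone.mixedHilbertFun I₁ I₂)
        (FiberCone.gCoeff d I₁ I₂) ∧
      FiberCone.IsHilbertCoeffs (d - 1) (FiberCone.fiberHilbertFun I₁ I₂)
        (FiberCone.fCoeff d I₁ I₂)) ∧
    -- (1)
    PowerSeries.mk (FiberCone.mixedHilbertFun I₁ I₂) =
      (PowerSeries.C (FiberCone.quotLength I₁) -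
          PowerSeries.X *
            PowerSeries.C (FiberCone.quotLength I₁ - FiberCone.eCoeff d I₂ 0)) *
        (PowerSeries.invOneSubPow ℤ (d + 1) : PowerSeries ℤ) ∧
    -- (2)
    (FiberCone.gCoeff d I₁ I₂ 1 = FiberCone.eCoeff d I₂ 0 - FiberCone.quotLength I₁ ∧
      ∀ i : ℕ, 2 ≤ i → i ≤ d → FiberCone.gCoeff d I₁ I₂ i = 0) ∧
    -- (3)
    PowerSeries.mk (FiberCone.fiberHilbertFun I₁ I₂) =
      (PowerSeries.C (FiberCone.quotLength I₁) -
          PowerSeries.X *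
            PowerSeries.C (FiberCone.quotLength I₁ - FiberCone.eCoeff d I₂ 0)) *
        (PowerSeries.invOneSubPow ℤ (d + 1) : PowerSeries ℤ) -
      PowerSeries.mk (FiberCone.hilbertFun I₂) ∧
    -- (4)
    (FiberCone.fCoeff d I₁ I₂ 0 =
        FiberCone.eCoeff d I₂ 1 - FiberCone.eCoeff d I₂ 0 + FiberCone.quotLength I₁ ∧
      ∀ i : ℕ, 1 ≤ i → i ≤ d - 1 →
        FiberCone.fCoeff d I₁ I₂ i = FiberCone.eCoeff d I₂ (i + 1)) := by
  open FiberCone in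
  obtain ⟨D, rfl⟩ : ∃ D, d = D + 1 := ⟨d - 1, by omega⟩
  obtain ⟨y, hy, hlen⟩ := hmm
  set Q := Ideal.span (Set.range y) with hQ
  have hreg : IsRegularlyGenerated (D + 1) Q :=
    isRegularlyGenerated_of_radical_eq hCM hdim y (hy.1.radical_eq.trans hI₂)
  have h12 : I₁ * I₂ = I₁ * Q :=
    le_antisymm (le_of_relLength_eq_zero hlen) (Ideal.mul_mono_right hy.1.1)
  have hmul : ∀ n, I₁ * I₂ ^ n = I₁ * Q ^ n := by
    intro n
    induction n with
    | zero => simp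
    | succ n ih => rw [pow_succ, ← mul_assoc, ih, mul_right_comm, h12, mul_assoc, ← pow_succ']
  have hQI₁ : Q ≤ I₁ := hy.le_of_isReduction hreg hmul hx.1 hxI₁
  have hfinQ := length_quotient_ne_top (hy.1.radical_eq.trans hI₂)
  have hfin₁ := length_quotient_ne_top hI₁
  -- Finiteness matters because `toNat` sends `⊤` to `0` and is additive only on finite lengths.
  have hfin : ∀ n, relLength (I₁ * I₂ ^ n) (I₂ ^ n) + Module.length R (R ⧸ I₂ ^ n) ≠ ⊤ := by
    intro n
    rw [← length_quotient_eq_add Ideal.mul_le_right]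
    exact length_quotient_ne_top (radical_mul_pow_eq hI₁ hI₂ n)
  have hfin' := fun n => WithTop.add_ne_top.1 (hfin n)
  have hmixed : mixedHilbertFun I₁ I₂ = fun n => quotLength I₁ * ((D + n).choose D : ℤ) +
      quotLength Q * ((D + n).choose (D + 1) : ℤ) := by
    funext n
    obtain ⟨a, ha⟩ := ENat.ne_top_iff_exists.1 hfin₁
    obtain ⟨b, hb⟩ := ENat.ne_top_iff_exists.1 hfinQ
    rw [mixedHilbertFun, hmul, quotLength, hreg.length_quotient_mul_pow hQI₁, quotLength,
      quotLength, ← ha, ← hb, ← Nat.cast_mul, ← Nat.cast_mul, ← Nat.cast_add, ENat.toNat_natCast,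
      ENat.toNat_natCast, ENat.toNat_natCast]
    push_cast
    ring
  have hhilb : hilbertFun I₂ = fun n => mixedHilbertFun I₁ I₂ n - fiberHilbertFun I₁ I₂ n := by
    funext n
    have h : mixedHilbertFun I₁ I₂ n = fiberHilbertFun I₁ I₂ n + hilbertFun I₂ n := by
      rw [mixedHilbertFun, quotLength, length_quotient_eq_add Ideal.mul_le_right,
        ENat.toNat_add (hfin' n).1 (hfin' n).2]
      push_cast
      rfl
    rw [h]
    ring
  obtain ⟨f, hf⟩ := (eventuallyBinomial_fiberHilbertFun hy.1
    fun n => (hfin' n).1).exists_isHilbertCoeffs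
  have hg := isHilbertCoeffs_choose D (quotLength I₁) (quotLength Q)
  rw [← hmixed] at hg
  have he := hg.sub hf
  rw [← hhilb] at he
  have hf' : fCoeff (D + 1) I₁ I₂ = f := hf.hilbertCoeffs_eq
  have hg' := hg.hilbertCoeffs_eq
  have he' := he.hilbertCoeffs_eq
  rw [← gCoeff] at hg'
  rw [← eCoeff] at he'
  -- The fiber cone contributes nothing in top degree, so the multiplicity is read off from the
  -- mixed function.
  have he0 : eCoeff (D + 1) I₂ 0 = quotLength Q := by rw [he']; simp
  have h1 := powerSeries_mk_choose D (quotLength I₁) (quotLength Q)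
  rw [← hmixed] at h1
  rw [he0, ← h1]
  refine ⟨⟨he' ▸ he, hg' ▸ hg, hf' ▸ hf⟩, rfl, ⟨by rw [hg']; simp, ?_⟩, ?_, ?_, ?_⟩
  · intro i hi _
    rw [hg']
    simp [show i ≠ 0 by omega, show i ≠ 1 by omega]
  · ext n
    rw [map_sub, PowerSeries.coeff_mk, PowerSeries.coeff_mk, PowerSeries.coeff_mk, hhilb]
    ring
  · rw [hf', he']
    simp only [if_true, one_ne_zero, if_false, Nat.sub_self]
    ring
  · intro i hi _
    rw [hf', he']
    simp [show i ≠ 0 by omega]
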